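/- Let $K$ be a field of characteristic $p>0$, let $S=K[x_1,\ldots,x_n]$, and let $0\neq f\in S$ be a polynomial whose support consists of square-free monomials (every variable has degree at most one in every monomial appearing in $f$ with non-zero coefficient). Write $f=\lambda f_1\cdots f_t$ with $\lambda\in K\smallsetminus\{0\}$ and $f_1,\ldots,f_t\in S$ irreducible ($t\ge 0$), and let $Q=(f_1,\ldots,f_t)$. Then $R=S/Q$ is geometrically F-rational, that is, for every field extension $L$ of $K$ the ring $R\otimes_K L$ is F-rational. Here a Noetherian ring $A$ of prime characteristic $p$ is called F-rational if every parameter ideal of $A$ is tightly closed. An ideal $I$ of $A$ is a parameter ideal if it has generators $a_1,\ldots,a_k$ such that for every prime ideal $\mathfrak p\supseteq I$ the images of $a_1,\ldots,a_k$ in $A_{\mathfrak p}$ form part of a system of parameters of $A_{\mathfrak p}$. An ideal $I$ is tightly closed if it contains every $x\in A$ for which there is $c\in A$, not in any minimal prime of $A$, with $c\,x^{p^e}\in I^{[p^e]}$ for all $e\gg 0$, where $I^{[p^e]}$ is the ideal generated by the $p^e$-th powers of the elements of $I$. -/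

import Mathlib

open scoped TensorProduct

universe u w

namespace FSing

/-- A polynomial is square-free supported if every monomial in its support is square-free. -/
def IsSquarefreeSupported {σ K : Type*} [CommSemiring K] (f : MvPolynomial σ K) : Prop :=
  ∀ m ∈ f.support, ∀ i, m i ≤ 1

section CommRing

variable {R : Type*} [CommRing R]

/-- The Frobenius power `I^[q]`: the ideal generated by the `q`-th powers of elements of `I`. -/
def frobeniusPower (I : Ideal R) (q : ℕ) : Ideal R :=
  Ideal.span ((fun x : R => x ^ q) '' (I : Set R))

/-- The tight closure of `I` in a ring of characteristic `p`: the set of all `x` for which there is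
`c` outside every minimal prime of `R` such that `c * x ^ (p ^ e) ∈ I^[p ^ e]` for all large `e`. -/
def tightClosure (p : ℕ) (I : Ideal R) : Set R :=
  {x | ∃ c : R, (∀ P ∈ minimalPrimes R, c ∉ P) ∧
    ∃ e₀ : ℕ, ∀ e ≥ e₀, c * x ^ (p ^ e) ∈ frobeniusPower I (p ^ e)}

/-- An ideal is tightly closed if it equals its tight closure. -/
def IsTightlyClosed (p : ℕ) (I : Ideal R) : Prop :=
  tightClosure p I = (I : Set R)

/-- A system of parameters of a Noetherian local ring `(A, 𝔪)`: a list of `dim A` elements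
generating an ideal whose radical is `𝔪`. -/
def IsSystemOfParameters {A : Type*} [CommRing A] [IsLocalRing A] (l : List A) : Prop :=
  (l.length : WithBot ℕ∞) = ringKrullDim A ∧
    (Ideal.ofList l).radical = IsLocalRing.maximalIdeal A

/-- A list that can be completed to a system of parameters. -/
def IsPartOfSystemOfParameters {A : Type*} [CommRing A] [IsLocalRing A] (l : List A) : Prop :=
  ∃ l' : List A, IsSystemOfParameters (l ++ l')

/-- A parameter ideal: it has a finite list of generators whose images in `R_P` form part of a
system of parameters of `R_P`, for every prime `P` containing the ideal. -/
def IsParameterIdeal (I : Ideal R) : Prop :=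
  ∃ l : List R, Ideal.ofList l = I ∧
    ∀ (P : Ideal R) [P.IsPrime], I ≤ P →
      IsPartOfSystemOfParameters (l.map (algebraMap R (Localization.AtPrime P)))

end CommRing

/-- `R` is an F-rational ring of characteristic `p`: a Noetherian ring of prime characteristic `p`
all of whose parameter ideals are tightly closed. -/
structure IsFRational (p : ℕ) (R : Type*) [CommRing R] : Prop where
  prime : p.Prime
  charP : CharP R p
  isNoetherianRing : IsNoetherianRing R
  isTightlyClosed : ∀ I : Ideal R, IsParameterIdeal I → IsTightlyClosed p I

/-- The `K`-algebra `R` is geometrically F-rational: `R ⊗ L` is F-rational for every field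
extension `L` of `K` (living in an arbitrary universe `w`). -/
def IsGeometricallyFRational (p : ℕ) (K R : Type*) [Field K] [CommRing R] [Algebra K R] : Prop :=
  ∀ (L : Type w) [Field L] [Algebra K L], IsFRational p (R ⊗[K] L)

end FSing

namespace FSing

open MvPolynomial

/-! In fact every ideal of S_L/Q_L is tightly closed, where S_L is the polynomial ring over L. Call
an ideal J compatible if φ(f^(q-1) J) ⊆ J for all q = p^e and all p^{-e}-linear φ. The ideal Q_L is
compatible. If x lies in the tight closure of I, its multipliers (those s with s x^q ∈ I^[q] for
large e) form a compatible ideal. Since f has degree at most one in each variable, some φ sends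
f^(q-1) to 1, so x ∈ I as soon as 1 is a multiplier. Otherwise the multipliers lie in a compatible
prime P ⊇ Q_L, and it remains to see that P is minimal over Q_L
(`isTightlyClosed_of_isCompatible_ker`).

The factors F_j involve disjoint sets of variables; choose x_j in F_j. Modulo Q_L, each x_j is a
fraction in the other variables, so minimality follows once P contains no nonzero polynomial free of
all x_j (`IsCompatible.eq_zero_of_vars_subset`). If it does, take one in a minimal set T of
variables and put P' = P ∩ L[T]. Compatibility forces the coefficients of f over L[T] into P', so
some F_j lies in P'S_L. For y ∈ T occurring in F_j, the Rayleigh difference of F_j in x_j and y lies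
in P'S_L and is free of y, hence vanishes by minimality of T. Irreducibility over K forbids this,
and nonvanishing survives extension to L, where irreducibility may fail. -/

/-! ### Coefficient extraction and p^{-e}-linear maps -/

theorem sumAlgEquiv_monomial {R S₁ S₂ : Type*} [CommSemiring R] (m : S₁ ⊕ S₂ →₀ ℕ) (c : R) :
    sumAlgEquiv R S₁ S₂ (monomial m c) =
      monomial (m.comapDomain Sum.inl Sum.inl_injective.injOn)
        (monomial (m.comapDomain Sum.inr Sum.inr_injective.injOn) c) := by
  simp [sumAlgEquiv, monomial]

theorem coeff_coeff_sumAlgEquiv {R S₁ S₂ : Type*} [CommSemiring R]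
    (p : MvPolynomial (S₁ ⊕ S₂) R) (a : S₁ →₀ ℕ) (b : S₂ →₀ ℕ) :
    coeff b (coeff a (sumAlgEquiv R S₁ S₂ p)) = coeff (Finsupp.sumElim a b) p := by
  classical
  induction p using MvPolynomial.induction_on' with
  | add p q hp hq => simp [hp, hq]
  | monomial m c =>
    rw [sumAlgEquiv_monomial, coeff_monomial, coeff_monomial, apply_ite (coeff b), coeff_monomial,
      coeff_zero, ← ite_and]
    congr 1
    rw [eq_iff_iff]
    constructor
    · rintro ⟨rfl, rfl⟩
      ext (i | i) <;> simp
    · rintro rfl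
      constructor <;> ext <;> simp

/-- `p^{-e}`-linear (`q = p^e`) additive maps. -/
def IsRootLinear {R : Type*} [CommRing R] (q : ℕ) (φ : R →+ R) : Prop :=
  ∀ r s, φ (r ^ q * s) = r * φ s

/-- The additive map on polynomials sending `∑ c_N X^N` to `∑ ψ (c_{m + q N}) X^N`. -/
noncomputable def cartierMap {σ A : Type*} [CommRing A] (q : ℕ) (hq : q ≠ 0) (ψ : A →+ A)
    (m : σ →₀ ℕ) : MvPolynomial σ A →+ MvPolynomial σ A :=
  have hinj : Function.Injective fun N : σ →₀ ℕ => m + q • N := fun a b h => by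
    ext i
    have h1 : m i + q * a i = m i + q * b i := by simpa using DFunLike.congr_fun h i
    exact Nat.eq_of_mul_eq_mul_left (Nat.pos_of_ne_zero hq) (Nat.add_left_cancel h1)
  { toFun := fun g => AddMonoidAlgebra.ofCoeff <|
      ((AddMonoidAlgebra.coeff g).comapDomain _ hinj.injOn).mapRange ψ ψ.map_zero
    map_zero' := by
      ext N
      exact ψ.map_zero
    map_add' := fun x y => by
      ext N
      exact ψ.map_add _ _ }

theorem coeff_cartierMap {σ A : Type*} [CommRing A] (q : ℕ) (hq : q ≠ 0) (ψ : A →+ A)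
    (m : σ →₀ ℕ) (g : MvPolynomial σ A) (N : σ →₀ ℕ) :
    coeff N (cartierMap q hq ψ m g) = ψ (coeff (m + q • N) g) :=
  rfl

theorem isRootLinear_cartierMap {σ A : Type*} [CommRing A] {p : ℕ} [Fact p.Prime] [CharP A p] (e : ℕ)
    (hq : p ^ e ≠ 0) {ψ : A →+ A}
    (hψ : IsRootLinear (p ^ e) ψ) (m : σ →₀ ℕ) (hm : ∀ i, m i < p ^ e) :
    IsRootLinear (p ^ e) (cartierMap (p ^ e) hq ψ m) := by
  intro r s
  induction r using MvPolynomial.induction_on' with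
  | add a b ha hb => rw [add_pow_char_pow, add_mul, map_add, ha, hb, add_mul]
  | monomial n a =>
    ext N
    have key : p ^ e • n ≤ m + p ^ e • N ↔ n ≤ N := by
      constructor
      · intro h i
        have h1 : p ^ e * n i ≤ m i + p ^ e * N i := by simpa using h i
        have h2 := hm i
        by_contra h3
        have h4 : N i + 1 ≤ n i := by omega
        have h5 := Nat.mul_le_mul_left (p ^ e) h4
        rw [Nat.mul_add] at h5
        omega
      · intro h i
        have := Nat.mul_le_mul_left (p ^ e) (h i)
        simp
        omega
    rw [coeff_cartierMap, monomial_pow, coeff_monomial_mul', coeff_monomial_mul', coeff_cartierMap]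
    simp only [key]
    split_ifs with h
    · rw [hψ]
      congr 3
      ext i
      have := Nat.mul_le_mul_left (p ^ e) (h i)
      simp [Nat.mul_sub]
      omega
    · simp

/-- The coefficient of an extremal square-free monomial in a power. -/
theorem coeff_smul_pow {σ A : Type*} [CommRing A] {f : MvPolynomial σ A}
    (hf : ∀ i, degreeOf i f ≤ 1) (M : σ →₀ ℕ) (hM : ∀ i, M i ≤ 1) (k : ℕ) :
    coeff (k • M) (f ^ k) = coeff M f ^ k := by
  classical
  induction k with
  | zero => simp
  | succ k ih =>
    rw [pow_succ, coeff_mul, pow_succ, ← ih]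
    rw [Finset.sum_eq_single (k • M, M)]
    · rintro ⟨a, b⟩ hab hne
      by_contra h0
      have ha : a ∈ (f ^ k).support := by
        rw [mem_support_iff]; exact left_ne_zero_of_mul h0
      have hb : b ∈ f.support := by
        rw [mem_support_iff]; exact right_ne_zero_of_mul h0
      apply hne
      replace hab : a + b = (k + 1) • M := Finset.HasAntidiagonal.mem_antidiagonal.1 hab
      -- Degrees are at most k in `f ^ k` and 1 in `f`, so where M is 1 both bounds are attained,
      -- and where M is 0 both exponents vanish.
      have hh : ∀ i, a i = k * M i ∧ b i = M i := by
        intro i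
        have h1 := (monomial_le_degreeOf i ha).trans (degreeOf_pow_le i f k)
        have h1' := h1.trans (Nat.mul_le_mul_left k (hf i))
        have h2 := (monomial_le_degreeOf i hb).trans (hf i)
        have h3 : a i + b i = (k + 1) * M i := by simpa using DFunLike.congr_fun hab i
        have h4 := hM i
        interval_cases M i <;> constructor <;> omega
      ext i
      · simp [(hh i).1]
      · simp [(hh i).2]
    · intro h
      exact absurd (by simp [add_smul]) h

/-- For N ≠ 0 the exponent (q-1)M + qN reaches q in some variable, beyond the degree q-1 of f^(q-1);
only the constant term survives. -/
theorem cartierMap_pow_mul_C {σ A : Type*} [CommRing A] {f : MvPolynomial σ A}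
    (hf : ∀ i, degreeOf i f ≤ 1) (M : σ →₀ ℕ) (hM : ∀ i, M i ≤ 1) {q : ℕ} (hq : q ≠ 0)
    (ψ : A →+ A) (a : A) :
    cartierMap q hq ψ ((q - 1) • M) (f ^ (q - 1) * C a) = C (ψ (coeff M f ^ (q - 1) * a)) := by
  classical
  ext N
  rw [coeff_cartierMap, mul_comm, coeff_C_mul, coeff_C]
  split_ifs with h
  · subst h
    rw [smul_zero, add_zero, coeff_smul_pow hf M hM, mul_comm]
  · rw [notMem_support_iff.1, mul_zero, map_zero]
    intro hs
    obtain ⟨i, hi⟩ : ∃ i, N i ≠ 0 := by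
      by_contra! h'
      exact h (by ext i; simp [h'])
    have h1 := ((monomial_le_degreeOf i hs).trans (degreeOf_pow_le i f _)).trans
      (Nat.mul_le_mul_left _ (hf i))
    have h2 : q * 1 ≤ q * N i := Nat.mul_le_mul_left _ (by omega)
    simp at h1 h2
    omega

/-- A p^{-e}-linear map is an L^q-linear functional on L followed by the q-th root; over a field
some functional is nonzero at c. -/
theorem exists_isRootLinear_field (L : Type*) [Field L] (p e : ℕ) [Fact p.Prime] [CharP L p]
    {c : L} (hc : c ≠ 0) : ∃ ψ : L →+ L, IsRootLinear (p ^ e) ψ ∧ ψ c = 1 := by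
  let fr : L →+* L := iterateFrobenius L p e
  have hfr (x : L) : fr x = x ^ p ^ e := rfl
  let θ : L ≃+* fr.fieldRange := RingEquiv.ofBijective fr.rangeRestrictField
    ⟨fr.rangeRestrictField.injective, fun ⟨_, x, hx⟩ => ⟨x, Subtype.ext hx⟩⟩
  obtain ⟨ℓ, hℓ⟩ : ∃ ℓ : Module.Dual fr.fieldRange L, ℓ c ≠ 0 := by
    by_contra! h
    exact hc ((Module.forall_dual_apply_eq_zero_iff fr.fieldRange c).1 h)
  refine ⟨θ.symm.toAddMonoidHom.comp ((ℓ c)⁻¹ • ℓ).toAddMonoidHom, fun r s => ?_, ?_⟩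
  · have h : r ^ p ^ e * s = θ r • s := rfl
    simp [h]
    ring
  · simp [hℓ]

/-- Once q exceeds the degree of h, no exponent m + qN with N ≠ 0 occurs in h, so extraction at a
monomial m of h sees only one coefficient. -/
theorem exists_isRootLinear_mvPolynomial {σ L : Type*} [Field L] (p : ℕ) [Fact p.Prime]
    [CharP L p] {h : MvPolynomial σ L} (hh : h ≠ 0) :
    ∃ e₀, ∀ e ≥ e₀, ∃ ψ : MvPolynomial σ L →+ MvPolynomial σ L,
      IsRootLinear (p ^ e) ψ ∧ ψ h = 1 := by
  classical
  obtain ⟨m, hm⟩ := exists_coeff_ne_zero hh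
  refine ⟨h.totalDegree + 1, fun e he => ?_⟩
  have hlt : h.totalDegree < p ^ e :=
    lt_of_lt_of_le (by omega) (Nat.lt_pow_self (Fact.out : p.Prime).one_lt).le
  have hdeg (N) (hN : N ∈ h.support) (i : σ) : N i < p ^ e :=
    ((monomial_le_degreeOf i hN).trans (degreeOf_le_totalDegree h i)).trans_lt hlt
  obtain ⟨ψ, hψ, h1⟩ := exists_isRootLinear_field L p e hm
  have hq : p ^ e ≠ 0 := by omega
  refine ⟨cartierMap _ hq ψ m, isRootLinear_cartierMap e hq hψ m
    (hdeg m (mem_support_iff.2 hm)), ?_⟩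
  ext N
  rw [coeff_cartierMap, coeff_one]
  split_ifs with hN
  · simp [← hN, h1]
  · rw [notMem_support_iff.1, map_zero]
    intro hs
    obtain ⟨i, hi⟩ : ∃ i, N i ≠ 0 := by
      by_contra! h'
      exact hN (by ext i; simp [h'])
    have h2 : p ^ e * 1 ≤ p ^ e * N i := Nat.mul_le_mul_left _ (by omega)
    have h3 := hdeg _ hs i
    simp at h3
    omega

/-! ### Separating the variables into two blocks -/

section Split

variable {σ Y Z L : Type*} [CommRing L]

/-- Polynomials in the variables `Y ⊕ Z` as polynomials in `Y` over the polynomial ring in `Z`. -/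
noncomputable def splitEquiv (L : Type*) [CommRing L] (u : σ ≃ Y ⊕ Z) :
    MvPolynomial σ L ≃ₐ[L] MvPolynomial Y (MvPolynomial Z L) :=
  (renameEquiv L u).trans (sumAlgEquiv L Y Z)

theorem coeff_coeff_splitEquiv (u : σ ≃ Y ⊕ Z) (g : MvPolynomial σ L) (a : Y →₀ ℕ) (b : Z →₀ ℕ) :
    coeff b (coeff a (splitEquiv L u g)) =
      coeff ((Finsupp.sumElim a b).mapDomain u.symm) g := by
  rw [splitEquiv, AlgEquiv.trans_apply, coeff_coeff_sumAlgEquiv, renameEquiv_apply,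
    ← coeff_rename_mapDomain u u.injective g, ← Finsupp.mapDomain_comp]
  simp

theorem mapDomain_symm_sumElim_inl (u : σ ≃ Y ⊕ Z) (a : Y →₀ ℕ) (b : Z →₀ ℕ) (y : Y) :
    (Finsupp.sumElim a b).mapDomain u.symm (u.symm (Sum.inl y)) = a y := by
  rw [Finsupp.mapDomain_apply u.symm.injective, Finsupp.sumElim_inl]

theorem mapDomain_symm_sumElim_inr (u : σ ≃ Y ⊕ Z) (a : Y →₀ ℕ) (b : Z →₀ ℕ) (z : Z) :
    (Finsupp.sumElim a b).mapDomain u.symm (u.symm (Sum.inr z)) = b z := by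
  rw [Finsupp.mapDomain_apply u.symm.injective, Finsupp.sumElim_inr]

theorem degreeOf_splitEquiv_le (u : σ ≃ Y ⊕ Z) (g : MvPolynomial σ L) (y : Y) :
    degreeOf y (splitEquiv L u g) ≤ degreeOf (u.symm (Sum.inl y)) g := by
  rw [degreeOf_le_iff]
  intro a ha
  obtain ⟨b, hb⟩ := exists_coeff_ne_zero (mem_support_iff.1 ha)
  rw [coeff_coeff_splitEquiv, ← mem_support_iff] at hb
  simpa [mapDomain_symm_sumElim_inl] using monomial_le_degreeOf (u.symm (Sum.inl y)) hb

theorem degreeOf_coeff_splitEquiv_le (u : σ ≃ Y ⊕ Z) (g : MvPolynomial σ L) (a : Y →₀ ℕ) (z : Z) :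
    degreeOf z (coeff a (splitEquiv L u g)) ≤ degreeOf (u.symm (Sum.inr z)) g := by
  rw [degreeOf_le_iff]
  intro b hb
  rw [mem_support_iff, coeff_coeff_splitEquiv, ← mem_support_iff] at hb
  simpa [mapDomain_symm_sumElim_inr] using monomial_le_degreeOf (u.symm (Sum.inr z)) hb

theorem splitEquiv_rename (u : σ ≃ Y ⊕ Z) (h : MvPolynomial Z L) :
    splitEquiv L u (rename (fun z => u.symm (Sum.inr z)) h) = C h := by
  have := DFunLike.congr_fun (sumAlgEquiv_comp_rename_inr (R := L) (S₁ := Y) (S₂ := Z)) h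
  simpa [splitEquiv, rename_rename, Function.comp_def] using this

theorem splitEquiv_pderiv (u : σ ≃ Y ⊕ Z) (g : MvPolynomial σ L) (y : Y) :
    splitEquiv L u (pderiv (u.symm (Sum.inl y)) g) = pderiv y (splitEquiv L u g) := by
  simp only [splitEquiv, AlgEquiv.trans_apply, pderiv_sumAlgEquiv, renameEquiv_apply]
  rw [← pderiv_rename u.injective, Equiv.apply_symm_apply]

end Split

/-! ### Compatible ideals and primes -/

section Compatible

/-- `J` is stable under all the maps `φ (f ^ (p ^ e - 1) * ·)` with `φ` a `p^{-e}`-linear map. -/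
def IsCompatible {R : Type*} [CommRing R] (p : ℕ) (f : R) (J : Ideal R) : Prop :=
  ∀ (e : ℕ) (φ : R →+ R), IsRootLinear (p ^ e) φ → ∀ s ∈ J, φ (f ^ (p ^ e - 1) * s) ∈ J

variable {σ Y Z L : Type*} [Field L] {p : ℕ} [Fact p.Prime] [CharP L p]

/-- With c the coefficient of f at M, extraction in the Y-variables gives ψ(c^(q-1) · c h) = c ψ(h),
and ψ is chosen with ψ(h) = 1. -/
theorem exists_isRootLinear_pow_mul {f : MvPolynomial σ L} (hf : ∀ i, degreeOf i f ≤ 1)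
    (u : σ ≃ Y ⊕ Z) {h : MvPolynomial Z L} (hh : h ≠ 0) (M : Y →₀ ℕ) :
    ∃ e₀, ∀ e ≥ e₀, ∃ φ : MvPolynomial σ L →+ MvPolynomial σ L, IsRootLinear (p ^ e) φ ∧
      φ (f ^ (p ^ e - 1) *
        rename (fun z => u.symm (Sum.inr z)) (coeff M (splitEquiv L u f) * h)) =
        rename (fun z => u.symm (Sum.inr z)) (coeff M (splitEquiv L u f)) := by
  obtain ⟨e₀, he₀⟩ := exists_isRootLinear_mvPolynomial p hh
  refine ⟨e₀, fun e he => ?_⟩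
  by_cases hM : coeff M (splitEquiv L u f) = 0
  · exact ⟨0, fun r s => by simp, by simp [hM]⟩
  obtain ⟨ψ, hψ, hψh⟩ := he₀ e he
  have hf' : ∀ y, degreeOf y (splitEquiv L u f) ≤ 1 := fun y =>
    (degreeOf_splitEquiv_le u f y).trans (hf _)
  have hM1 : ∀ y, M y ≤ 1 := fun y =>
    (monomial_le_degreeOf y (mem_support_iff.2 hM)).trans (hf' y)
  have hq : 0 < p ^ e := pow_pos (Fact.out : p.Prime).pos e
  have hlin := isRootLinear_cartierMap e hq.ne' hψ ((p ^ e - 1) • M) fun y => by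
    have := Nat.mul_le_mul_left (p ^ e - 1) (hM1 y)
    simp
    omega
  let E := splitEquiv L u
  refine ⟨E.symm.toRingEquiv.toAddMonoidHom.comp
    ((cartierMap _ hq.ne' ψ ((p ^ e - 1) • M)).comp E.toRingEquiv.toAddMonoidHom),
    fun r s => ?_, ?_⟩
  · have := hlin (E r) (E s)
    simp [this]
  · have := cartierMap_pow_mul_C hf' M hM1 hq.ne' ψ (coeff M (splitEquiv L u f) * h)
    rw [← mul_assoc, ← pow_succ, Nat.sub_add_cancel hq, hψ, hψh, mul_one] at this
    apply E.injective
    simpa [E, splitEquiv_rename] using this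

theorem IsCompatible.rename_coeff_mem {f : MvPolynomial σ L} (hf : ∀ i, degreeOf i f ≤ 1)
    {J : Ideal (MvPolynomial σ L)} (hJ : IsCompatible p f J) (u : σ ≃ Y ⊕ Z)
    {h : MvPolynomial Z L} (hh : h ≠ 0) (hhJ : rename (fun z => u.symm (Sum.inr z)) h ∈ J)
    (M : Y →₀ ℕ) :
    rename (fun z => u.symm (Sum.inr z)) (coeff M (splitEquiv L u f)) ∈ J := by
  obtain ⟨e, he⟩ := exists_isRootLinear_pow_mul (p := p) hf u hh M
  obtain ⟨φ, hφ, h1⟩ := he e le_rfl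
  rw [← h1]
  refine hJ e φ hφ _ ?_
  rw [map_mul]
  exact J.mul_mem_left _ hhJ

theorem IsCompatible.colon_singleton {R : Type*} [CommRing R] {f : R} {J : Ideal R}
    (hJ : IsCompatible p f J) (c : R) : IsCompatible p f (J.colon {c}) := by
  intro e φ hφ s hs
  rw [Submodule.mem_colon_singleton, smul_eq_mul] at hs ⊢
  have : φ (f ^ (p ^ e - 1) * s) * c = φ (f ^ (p ^ e - 1) * (s * c ^ p ^ e)) := by
    rw [mul_comm, ← hφ]
    ring_nf
  rw [this]
  refine hJ e φ hφ _ ?_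
  have hq : p ^ e - 1 + 1 = p ^ e := Nat.sub_add_cancel (pow_pos (Fact.out : p.Prime).pos e)
  rw [← hq, pow_succ', ← mul_assoc]
  exact J.mul_mem_right _ hs

/-- A maximal proper compatible ideal is prime because colons by elements remain compatible. -/
theorem exists_isPrime_isCompatible {R : Type*} [CommRing R] [IsNoetherianRing R] {f : R}
    {J : Ideal R} (hJ : IsCompatible p f J) (hJ1 : J ≠ ⊤) :
    ∃ P : Ideal R, P.IsPrime ∧ IsCompatible p f P ∧ J ≤ P := by
  obtain ⟨P, ⟨hP, hPtop, hJP⟩, hmax⟩ := set_has_maximal_iff_noetherian.2 ‹IsNoetherianRing R›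
    {P : Ideal R | IsCompatible p f P ∧ P ≠ ⊤ ∧ J ≤ P} ⟨J, hJ, hJ1, le_rfl⟩
  refine ⟨P, ⟨hPtop, fun {x y} hxy => ?_⟩, hP, hJP⟩
  by_contra! hcon
  have hle : P ≤ P.colon {y} := fun z hz =>
    Submodule.mem_colon_singleton.2 (Ideal.mul_mem_right y P hz)
  refine hmax (P.colon {y}) ⟨hP.colon_singleton y, fun htop => hcon.2 ?_, hJP.trans hle⟩
    (lt_of_le_of_ne hle fun heq => hcon.1 ?_)
  · have : (1 : R) ∈ P.colon {y} := htop ▸ trivial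
    simpa using Submodule.mem_colon_singleton.1 this
  · rw [heq]
    exact Submodule.mem_colon_singleton.2 hxy

end Compatible

/-! ### Rayleigh differences -/

section PDeriv

variable {σ R : Type*} [CommRing R]

theorem degreeOf_pderiv_le (x y : σ) (F : MvPolynomial σ R) :
    degreeOf y (pderiv x F) ≤ degreeOf y F := by
  classical
  rw [degreeOf_le_iff]
  intro m hm
  rw [mem_support_iff, coeff_pderiv] at hm
  have := monomial_le_degreeOf y (mem_support_iff.2 (left_ne_zero_of_mul hm))
  rw [Finsupp.add_apply] at this
  omega

theorem degreeOf_pderiv_self {y : σ} {F : MvPolynomial σ R} (hF : degreeOf y F ≤ 1) :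
    degreeOf y (pderiv y F) = 0 := by
  rw [← Nat.le_zero, degreeOf_le_iff]
  intro m hm
  rw [mem_support_iff, coeff_pderiv] at hm
  have := monomial_le_degreeOf y (mem_support_iff.2 (left_ne_zero_of_mul hm))
  simp at this
  omega

theorem degreeOf_sub_X_mul_pderiv {y : σ} {F : MvPolynomial σ R} (hF : degreeOf y F ≤ 1) :
    degreeOf y (F - X y * pderiv y F) = 0 := by
  classical
  rw [← Nat.le_zero, degreeOf_le_iff]
  intro m hm
  by_contra! h0
  rw [mem_support_iff, coeff_sub, coeff_X_mul', if_pos (Finsupp.mem_support_iff.2 h0.ne'),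
    coeff_pderiv] at hm
  have hm1 : m - Finsupp.single y 1 + Finsupp.single y 1 = m :=
    tsub_add_cancel_of_le (Finsupp.single_le_iff.2 h0)
  rw [hm1] at hm
  have hc : coeff m F ≠ 0 := by
    intro h
    simp [h] at hm
  have h1 := (monomial_le_degreeOf y (mem_support_iff.2 hc)).trans hF
  have h2 : m y = 1 := by omega
  simp [h2] at hm

theorem degreeOf_sub_X_mul_pderiv_le {x y : σ} (hxy : x ≠ y) (F : MvPolynomial σ R) :
    degreeOf x (F - X y * pderiv y F) ≤ degreeOf x F := by
  classical
  refine (degreeOf_sub_le _ _ _).trans (max_le le_rfl ?_)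
  rw [mul_comm, degreeOf_mul_X_of_ne _ hxy]
  exact degreeOf_pderiv_le _ _ _

/-- The Rayleigh difference of a polynomial with respect to two variables. -/
noncomputable def rayleigh (x y : σ) (F : MvPolynomial σ R) : MvPolynomial σ R :=
  pderiv y F * pderiv x F - pderiv x (pderiv y F) * F

/-- Writing F = b + y a with a and b free of y, the terms in y cancel and leave a ∂ₓb - b ∂ₓa. -/
theorem degreeOf_rayleigh {x y : σ} (hxy : x ≠ y) {F : MvPolynomial σ R} (hF : degreeOf y F ≤ 1) :
    degreeOf y (rayleigh x y F) = 0 := by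
  set a := pderiv y F with ha
  set b := F - X y * a with hb
  have ha0 : degreeOf y a = 0 := degreeOf_pderiv_self hF
  have hb0 : degreeOf y b = 0 := degreeOf_sub_X_mul_pderiv hF
  have ha1 := degreeOf_pderiv_le x y a
  have hb1 := degreeOf_pderiv_le x y b
  have h1 := degreeOf_mul_le y a (pderiv x b)
  have h2 := degreeOf_mul_le y (pderiv x a) b
  have hFab : F = b + X y * a := by rw [hb]; ring
  have hX : pderiv x (X y : MvPolynomial σ R) = 0 := pderiv_X_of_ne hxy.symm
  have key : rayleigh x y F = a * pderiv x b - pderiv x a * b := by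
    rw [rayleigh, ← ha]
    have : pderiv x F = pderiv x b + X y * pderiv x a := by
      conv_lhs => rw [hFab]
      rw [map_add, pderiv_mul, hX]
      ring
    rw [this]
    conv_lhs => rw [hFab]
    ring
  rw [key]
  have := degreeOf_sub_le y (a * pderiv x b) (pderiv x a * b)
  have h3 := max_le_max h1 h2
  rw [← Nat.le_zero]
  refine this.trans (h3.trans ?_)
  rw [max_le_iff]
  omega

theorem rayleigh_map {S : Type*} [CommRing S] (φ : R →+* S) (x y : σ) (F : MvPolynomial σ R) :
    rayleigh x y (map φ F) = map φ (rayleigh x y F) := by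
  simp [rayleigh, pderiv_map]

/-- Vanishing would make the prime F divide one of its two first derivatives, each nonzero and of
smaller degree in its variable. -/
theorem rayleigh_ne_zero {K : Type*} [Field K] {F : MvPolynomial σ K}
    (hF : Irreducible F) {x y : σ} (hx : degreeOf x F = 1) (hy : degreeOf y F = 1) :
    rayleigh x y F ≠ 0 := by
  intro h0
  have key (z : σ) (hz : degreeOf z F = 1) : ¬ F ∣ pderiv z F := by
    rintro ⟨G, hG⟩
    by_cases hG0 : pderiv z F = 0
    · have := degreeOf_sub_X_mul_pderiv hz.le
      rw [hG0, mul_zero, sub_zero] at this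
      omega
    · have := degreeOf_pderiv_self hz.le
      rw [hG, degreeOf_mul_eq hF.ne_zero fun h => hG0 (by rw [hG, h, mul_zero])] at this
      omega
  have hdvd : F ∣ pderiv y F * pderiv x F := by
    rw [rayleigh, sub_eq_zero] at h0
    exact ⟨pderiv x (pderiv y F), by rw [h0, mul_comm]⟩
  rcases hF.prime.dvd_or_dvd hdvd with h | h
  · exact key y hy h
  · exact key x hx h

theorem degreeOf_map_of_injective {S : Type*} [CommRing S] {φ : R →+* S}
    (hφ : Function.Injective φ) (x : σ) (F : MvPolynomial σ R) :
    degreeOf x (map φ F) = degreeOf x F := by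
  classical
  rw [degreeOf_def, degreeOf_def, degrees_map_of_injective _ hφ]

end PDeriv

/-! ### Compatible primes avoid the remaining variables -/

section Contraction

variable {σ L ι : Type*} [Field L] [Fintype ι] {p : ℕ} [Fact p.Prime] [CharP L p]

/-- A compatible prime contains no nonzero polynomial avoiding one variable of each factor. -/
theorem IsCompatible.eq_zero_of_vars_subset {F : ι → MvPolynomial σ L}
    (hF : ∀ i, degreeOf i (∏ j, F j) ≤ 1) (hF1 : ∀ j i, degreeOf i (F j) ≤ 1)
    (hF0 : ∀ j, F j ≠ 0) (x : ι → σ)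
    (hΔ : ∀ j y, y ≠ x j → degreeOf y (F j) ≠ 0 → rayleigh (x j) y (F j) ≠ 0)
    {P : Ideal (MvPolynomial σ L)} (hP : P.IsPrime) (hc : IsCompatible p (∏ j, F j) P)
    (T : Finset σ) (hT : ∀ j, x j ∉ T) (h : MvPolynomial σ L) (hhP : h ∈ P) (hv : h.vars ⊆ T) :
    h = 0 := by
  classical
  induction T using Finset.strongInduction generalizing h with
  | H T ih =>
    by_contra hh0
    let u : σ ≃ {i // i ∉ T} ⊕ {i // i ∈ T} :=
      (Equiv.sumCompl (· ∈ T)).symm.trans (Equiv.sumComm _ _)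
    have hur : (fun z : {i // i ∈ T} => u.symm (Sum.inr z)) = Subtype.val := by
      ext z
      simp [u]
    let ρ : MvPolynomial {i // i ∈ T} L →+* MvPolynomial σ L :=
      (rename (R := L) (Subtype.val : {i // i ∈ T} → σ)).toRingHom
    let P' := P.comap ρ
    have hP' : P'.IsPrime := Ideal.comap_isPrime ρ P
    -- Induction hypothesis: an element of P' missing some y ∈ T lives on the smaller set T \ {y}.
    have hρ (a) (y : {i // i ∈ T}) (ha : degreeOf y a = 0) (haP : a ∈ P') : a = 0 := by
      have h1 : ρ a = 0 := by
        refine ih (T.erase y) (Finset.erase_ssubset y.2)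
          (fun j hj => hT j (Finset.mem_of_mem_erase hj)) (ρ a) haP fun i hi => ?_
        obtain ⟨z, hz, rfl⟩ := Finset.mem_image.1 (vars_rename _ _ hi)
        refine Finset.mem_erase.2 ⟨fun hzy => ?_, z.2⟩
        rw [Subtype.ext hzy, mem_vars_iff_degreeOf_ne_zero] at hz
        exact hz ha
      exact rename_injective _ Subtype.val_injective (by simpa [ρ] using h1)
    have key (y : {i // i ∈ T}) (G : MvPolynomial σ L) (hG : degreeOf y.1 G = 0)
        (hGP : splitEquiv L u G ∈ P'.map C) : G = 0 := by
      rw [← EmbeddingLike.map_eq_zero_iff (f := splitEquiv L u)]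
      ext M : 1
      refine hρ _ y ?_ (mem_map_C_iff.1 hGP M)
      have := degreeOf_coeff_splitEquiv_le u G M y
      rw [congr_fun hur y] at this
      omega
    obtain ⟨h', rfl⟩ := exists_rename_eq_of_vars_subset_range h
      (Subtype.val : {i // i ∈ T} → σ) Subtype.val_injective (by simpa using hv)
    have hh' : h' ≠ 0 := by
      rintro rfl
      simp at hh0
    have hprod : splitEquiv L u (∏ j, F j) ∈ P'.map C := by
      refine mem_map_C_iff.2 fun M => ?_
      have := hc.rename_coeff_mem hF u hh' (by rwa [hur]) M
      rwa [hur] at this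
    obtain ⟨j, hj⟩ : ∃ j, splitEquiv L u (F j) ∈ P'.map C := by
      -- P'S is the kernel of reduction to polynomials over the domain L[T]/P', hence prime.
      have hker (G : MvPolynomial {i // i ∉ T} (MvPolynomial {i // i ∈ T} L)) :
          G ∈ P'.map C ↔ map (Ideal.Quotient.mk P') G = 0 := by
        rw [mem_map_C_iff, MvPolynomial.ext_iff]
        refine forall_congr' fun m => ?_
        rw [coeff_map, coeff_zero, Ideal.Quotient.eq_zero_iff_mem]
      rw [hker, map_prod, map_prod, Finset.prod_eq_zero_iff] at hprod
      obtain ⟨j, -, hj⟩ := hprod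
      exact ⟨j, (hker _).2 hj⟩
    obtain ⟨y, hy⟩ : ∃ y : {i // i ∈ T}, degreeOf y.1 (F j) ≠ 0 := by
      by_contra! hcon
      rcases T.eq_empty_or_nonempty with rfl | ⟨y, hy⟩
      · have : (rename Subtype.val h' : MvPolynomial σ L).vars = ∅ := Finset.subset_empty.1 hv
        rw [vars_eq_empty_iff_eq_C] at this
        rw [this] at hhP hh0
        refine hP.ne_top (P.eq_top_of_isUnit_mem hhP ?_)
        exact (IsUnit.mk0 _ fun h0 => hh0 (by rw [h0, C_0])).map C
      · exact hF0 j (key ⟨y, hy⟩ _ (hcon _) hj)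
    have hyx : y.1 ≠ x j := fun h => hT j (h ▸ y.2)
    refine hΔ j y hyx hy (key y _ (degreeOf_rayleigh hyx.symm (hF1 j y)) ?_)
    -- As x_j ∉ T, differentiation in x_j treats L[T] as constants and preserves P'S.
    have hpd : splitEquiv L u (pderiv (x j) (F j)) ∈ P'.map C := by
      have hx : u.symm (Sum.inl ⟨x j, hT j⟩) = x j := by simp [u]
      rw [← hx, splitEquiv_pderiv]
      refine mem_map_C_iff.2 fun M => ?_
      rw [coeff_pderiv]
      exact P'.mul_mem_right _ (mem_map_C_iff.1 hj _)
    rw [rayleigh, map_sub, map_mul, map_mul]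
    exact Ideal.sub_mem _ (Ideal.mul_mem_left _ _ hpd) (Ideal.mul_mem_left _ _ hj)

end Contraction

/-! ### Solving for the chosen variables -/

section Generic

variable {σ L ι : Type*} [Field L]

theorem mem_supported_of_degreeOf_eq_zero {x : ι → σ} {a : MvPolynomial σ L}
    (ha : ∀ j, degreeOf (x j) a = 0) : a ∈ supported L (Set.range x)ᶜ := by
  rw [mem_supported]
  rintro i hi ⟨j, rfl⟩
  exact mem_vars_iff_degreeOf_ne_zero.1 hi (ha j)

theorem pderiv_mem_supported {F : MvPolynomial σ L} {x : ι → σ} {j : ι}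
    (hx : degreeOf (x j) F = 1) (hx' : ∀ k, k ≠ j → degreeOf (x k) F = 0) :
    pderiv (x j) F ∈ supported L (Set.range x)ᶜ := by
  refine mem_supported_of_degreeOf_eq_zero fun k => ?_
  rcases eq_or_ne k j with rfl | hk
  · exact degreeOf_pderiv_self hx.le
  · exact Nat.le_zero.1 ((degreeOf_pderiv_le _ _ _).trans (hx' k hk).le)

theorem sub_X_mul_pderiv_mem_supported {F : MvPolynomial σ L} {x : ι → σ} {j : ι}
    (hx : degreeOf (x j) F = 1) (hx' : ∀ k, k ≠ j → degreeOf (x k) F = 0) :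
    F - X (x j) * pderiv (x j) F ∈ supported L (Set.range x)ᶜ := by
  refine mem_supported_of_degreeOf_eq_zero fun k => ?_
  rcases eq_or_ne k j with rfl | hk
  · exact degreeOf_sub_X_mul_pderiv hx.le
  · refine Nat.le_zero.1 ((degreeOf_sub_X_mul_pderiv_le ?_ _).trans (hx' k hk).le)
    intro h
    have := hx' k hk
    rw [h] at this
    omega

theorem pderiv_ne_zero_of_degreeOf_eq_one {F : MvPolynomial σ L} {y : σ}
    (hy : degreeOf y F = 1) : pderiv y F ≠ 0 := by
  intro h
  have := degreeOf_sub_X_mul_pderiv hy.le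
  rw [h, mul_zero, sub_zero] at this
  omega

/-- Each F_j = a x_j + b, with a ≠ 0 and b free of all chosen variables, gives a x_j ≡ -b;
denominators are then cleared. -/
theorem exists_mul_sub_mem_span {F : ι → MvPolynomial σ L} {x : ι → σ}
    (hx : ∀ j, degreeOf (x j) (F j) = 1) (hx' : ∀ j k, k ≠ j → degreeOf (x k) (F j) = 0)
    (h : MvPolynomial σ L) :
    ∃ a ∈ supported L (Set.range x)ᶜ, ∃ r ∈ supported L (Set.range x)ᶜ,
      a ≠ 0 ∧ a * h - r ∈ Ideal.span (Set.range F) := by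
  have hX (i : σ) : ∃ a ∈ supported L (Set.range x)ᶜ, ∃ r ∈ supported L (Set.range x)ᶜ,
      a ≠ 0 ∧ a * X i - r ∈ Ideal.span (Set.range F) := by
    by_cases hi : i ∈ Set.range x
    · obtain ⟨j, rfl⟩ := hi
      refine ⟨_, pderiv_mem_supported (hx j) (hx' j), _,
        Subalgebra.neg_mem _ (sub_X_mul_pderiv_mem_supported (hx j) (hx' j)),
        pderiv_ne_zero_of_degreeOf_eq_one (hx j), ?_⟩
      have hj : F j ∈ Ideal.span (Set.range F) := Ideal.subset_span (Set.mem_range_self j)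
      convert hj using 1
      ring
    · exact ⟨1, Subalgebra.one_mem _, X i, X_mem_supported.2 hi, one_ne_zero, by simp⟩
  induction h using MvPolynomial.induction_on with
  | C c => exact ⟨1, Subalgebra.one_mem _, C c, Subalgebra.algebraMap_mem _ c, one_ne_zero,
      by simp⟩
  | add f g hf hg =>
    obtain ⟨a, ha, r, hr, ha0, h1⟩ := hf
    obtain ⟨b, hb, s, hs, hb0, h2⟩ := hg
    refine ⟨a * b, mul_mem ha hb, b * r + a * s, add_mem (mul_mem hb hr) (mul_mem ha hs),
      mul_ne_zero ha0 hb0, ?_⟩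
    convert Ideal.add_mem _ (Ideal.mul_mem_left _ b h1) (Ideal.mul_mem_left _ a h2) using 1
    ring
  | mul_X f i hf =>
    obtain ⟨a, ha, r, hr, ha0, h1⟩ := hf
    obtain ⟨b, hb, s, hs, hb0, h2⟩ := hX i
    refine ⟨a * b, mul_mem ha hb, r * s, mul_mem hr hs, mul_ne_zero ha0 hb0, ?_⟩
    convert Ideal.add_mem _ (Ideal.mul_mem_left _ (b * X i) h1) (Ideal.mul_mem_left _ r h2) using 1
    ring

/-- The substitution x_j = -b/a in the fraction field is a common zero of the F_j. -/
theorem span_range_ne_top {F : ι → MvPolynomial σ L} {x : ι → σ}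
    (hx : ∀ j, degreeOf (x j) (F j) = 1) (hx' : ∀ j k, k ≠ j → degreeOf (x k) (F j) = 0) :
    Ideal.span (Set.range F) ≠ ⊤ := by
  classical
  let k := FractionRing (MvPolynomial σ L)
  let κ : MvPolynomial σ L →+* k := algebraMap _ _
  let v : σ → k := fun i =>
    if h : ∃ j, x j = i then
      -κ (F h.choose - X (x h.choose) * pderiv (x h.choose) (F h.choose)) /
        κ (pderiv (x h.choose) (F h.choose))
    else κ (X i)
  let θ : MvPolynomial σ L →+* k := eval₂Hom (κ.comp C) v
  have hθ (a) (ha : a ∈ supported L (Set.range x)ᶜ) : θ a = κ a := by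
    refine hom_congr_vars ?_ (fun i hi _ => ?_) rfl
    · ext c
      simp [θ]
    · have hi' : ¬ ∃ j, x j = i := mem_supported.1 ha hi
      simp only [θ, eval₂Hom_X', v, dif_neg hi']
  have hinj : Function.Injective x := by
    intro i j hij
    by_contra hne
    have := hx' j i hne
    rw [hij, hx j] at this
    omega
  have hF (j) : θ (F j) = 0 := by
    have hex : ∃ j', x j' = x j := ⟨j, rfl⟩
    have hj : hex.choose = j := hinj hex.choose_spec
    have h1 := hθ _ (pderiv_mem_supported (hx j) (hx' j))
    have h2 := hθ _ (sub_X_mul_pderiv_mem_supported (hx j) (hx' j))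
    have h3 : θ (X (x j)) = -κ (F j - X (x j) * pderiv (x j) (F j)) / κ (pderiv (x j) (F j)) := by
      simp only [θ, eval₂Hom_X', v, dif_pos hex]
      rw [hj]
    have h4 : κ (pderiv (x j) (F j)) ≠ 0 := by
      rw [Ne, map_eq_zero_iff κ (IsFractionRing.injective _ _)]
      exact pderiv_ne_zero_of_degreeOf_eq_one (hx j)
    rw [map_sub θ, map_mul θ, h1, h3, div_mul_cancel₀ _ h4] at h2
    linear_combination h2
  intro htop
  have hle : Ideal.span (Set.range F) ≤ RingHom.ker θ := by
    rw [Ideal.span_le]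
    rintro _ ⟨j, rfl⟩
    exact hF j
  have : (1 : MvPolynomial σ L) ∈ RingHom.ker θ := hle (htop ▸ trivial)
  rw [RingHom.mem_ker, map_one] at this
  exact one_ne_zero this

end Generic

/-! ### From compatible primes to tight closure -/

section TightClosure

variable {p : ℕ}

theorem IsRootLinear.map_frobeniusPower {B : Type*} [CommRing B] {q q' : ℕ} {φ : B →+ B}
    (hφ : IsRootLinear q φ) {I : Ideal B} {y : B} (hy : y ∈ frobeniusPower I (q' * q)) :
    φ y ∈ frobeniusPower I q' := by
  rw [frobeniusPower] at hy
  suffices ∀ b, φ (b * y) ∈ frobeniusPower I q' by simpa using this 1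
  induction hy using Submodule.span_induction with
  | mem y hy =>
    obtain ⟨i, hi, rfl⟩ := hy
    intro b
    change φ (b * i ^ (q' * q)) ∈ _
    rw [mul_comm, pow_mul, hφ]
    exact Ideal.mul_mem_right _ _ (Ideal.subset_span ⟨i, hi, rfl⟩)
  | zero => simp
  | add y z _ _ h1 h2 =>
    intro b
    rw [mul_add, map_add]
    exact Ideal.add_mem _ (h1 b) (h2 b)
  | smul c y _ h =>
    intro b
    rw [smul_eq_mul, ← mul_assoc]
    exact h _

theorem exists_isRootLinear_of_isCompatible_ker {S B : Type*} [CommRing S] [CommRing B]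
    {π : S →+* B} (hπ : Function.Surjective π) {f : S} (hf : IsCompatible p f (RingHom.ker π))
    {e : ℕ} {φ : S →+ S} (hφ : IsRootLinear (p ^ e) φ) :
    ∃ φ' : B →+ B, IsRootLinear (p ^ e) φ' ∧ ∀ s, φ' (π s) = π (φ (f ^ (p ^ e - 1) * s)) := by
  let g : S →+ B := π.toAddMonoidHom.comp (φ.comp (AddMonoidHom.mulLeft (f ^ (p ^ e - 1))))
  let φ' : B →+ B := (π.toAddMonoidHom).liftOfSurjective hπ ⟨g, fun s hs => hf e φ hφ s hs⟩
  have h (s) : φ' (π s) = π (φ (f ^ (p ^ e - 1) * s)) :=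
    AddMonoidHom.liftOfRightInverse_comp_apply _ _ _ _ s
  refine ⟨φ', fun r s => ?_, h⟩
  obtain ⟨r, rfl⟩ := hπ r
  obtain ⟨s, rfl⟩ := hπ s
  rw [← map_pow, ← map_mul, h, h, ← map_mul, ← hφ, mul_left_comm]

theorem isTightlyClosed_of_isCompatible_ker [Fact p.Prime] {S B : Type*} [CommRing S]
    [IsNoetherianRing S] [CommRing B]
    {π : S →+* B} (hπ : Function.Surjective π) {f : S} (hf : IsCompatible p f (RingHom.ker π))
    (hsplit : ∀ e, ∃ φ : S →+ S, IsRootLinear (p ^ e) φ ∧ φ (f ^ (p ^ e - 1)) = 1)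
    (hmin : ∀ P : Ideal S, P.IsPrime → IsCompatible p f P → RingHom.ker π ≤ P →
      ∀ P₀ : Ideal S, P₀.IsPrime → RingHom.ker π ≤ P₀ → P₀ ≤ P → P ≤ P₀)
    (I : Ideal B) : IsTightlyClosed p I := by
  refine Set.Subset.antisymm ?_ fun x hx => ?_
  · rintro x ⟨c, hc, e₀, he₀⟩
    let J : Ideal S :=
      { carrier := {s | ∃ e₀ : ℕ, ∀ e ≥ e₀, π s * x ^ p ^ e ∈ frobeniusPower I (p ^ e)}
        add_mem' := by
          rintro a b ⟨e₁, h₁⟩ ⟨e₂, h₂⟩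
          refine ⟨max e₁ e₂, fun e he => ?_⟩
          rw [map_add, add_mul]
          exact Ideal.add_mem _ (h₁ e (le_of_max_le_left he)) (h₂ e (le_of_max_le_right he))
        zero_mem' := ⟨0, fun e _ => by simp⟩
        smul_mem' := by
          rintro a b ⟨e₁, h₁⟩
          refine ⟨e₁, fun e he => ?_⟩
          rw [smul_eq_mul, map_mul, mul_assoc]
          exact Ideal.mul_mem_left _ _ (h₁ e he) }
    have hJ : IsCompatible p f J := by
      rintro e' φ hφ s ⟨e₁, h₁⟩
      obtain ⟨φ', hφ', h⟩ := exists_isRootLinear_of_isCompatible_ker hπ hf hφ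
      refine ⟨e₁, fun e he => ?_⟩
      -- Root-linearity moves x^(p^e) inside φ' as x^(p^(e+e')).
      rw [← h, mul_comm, ← hφ', ← pow_mul, ← pow_add, mul_comm]
      refine hφ'.map_frobeniusPower ?_
      rw [← pow_add]
      exact h₁ _ (by omega)
    by_cases htop : J = ⊤
    · obtain ⟨e, he⟩ : (1 : S) ∈ J := htop ▸ trivial
      have h1 := he e le_rfl
      rw [map_one, one_mul] at h1
      obtain ⟨φ, hφ, hφ1⟩ := hsplit e
      obtain ⟨φ', hφ', h⟩ := exists_isRootLinear_of_isCompatible_ker hπ hf hφ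
      have h2 : φ' (x ^ p ^ e) = x := by
        have h3 := hφ' x 1
        have h4 := h 1
        rw [mul_one, hφ1, map_one] at h4
        rwa [mul_one, h4, mul_one] at h3
      have h3 : φ' (x ^ p ^ e) ∈ frobeniusPower I 1 :=
        hφ'.map_frobeniusPower (by rwa [one_mul])
      rw [h2, frobeniusPower] at h3
      simpa using h3
    · exfalso
      obtain ⟨P, hP, hPc, hJP⟩ := exists_isPrime_isCompatible hJ htop
      have hker : RingHom.ker π ≤ P := fun s hs => hJP ⟨0, fun e _ => by
        rw [RingHom.mem_ker.1 hs, zero_mul]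
        exact Ideal.zero_mem _⟩
      obtain ⟨c, rfl⟩ := hπ c
      have hcP : c ∈ P := hJP ⟨e₀, he₀⟩
      have hP' : (P.map π).IsPrime := Ideal.map_isPrime_of_surjective hπ hker
      obtain ⟨Q, hQ, hQP⟩ := Ideal.exists_minimalPrimes_le (I := ⊥) (J := P.map π) bot_le
      have hQ' : Q.IsPrime := hQ.1.1
      have hle := hmin P hP hPc hker (Q.comap π) (Ideal.comap_isPrime π Q)
        (fun s hs => by
          rw [Ideal.mem_comap, RingHom.mem_ker.1 hs]
          exact Q.zero_mem)
        (by
          refine (Ideal.comap_mono hQP).trans ?_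
          rw [Ideal.comap_map_of_surjective π hπ]
          exact sup_le le_rfl hker)
      exact hc Q hQ (hle hcP)
  · refine ⟨1, fun P hP => (Ideal.ne_top_iff_one P).1 hP.1.1.ne_top, 0, fun e _ => ?_⟩
    rw [one_mul]
    exact Ideal.subset_span ⟨x, hx, rfl⟩

end TightClosure

/-! ### The ideal of factors -/

section Hypersurface

variable {σ L ι : Type*} [Field L] [Fintype ι] {p : ℕ} [Fact p.Prime] [CharP L p]

theorem isCompatible_span_range {R : Type*} [CommRing R] (F : ι → R) :
    IsCompatible p (∏ j, F j) (Ideal.span (Set.range F)) := by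
  classical
  intro e φ hφ s hs
  induction hs using Submodule.span_induction generalizing φ with
  | mem y hy =>
    obtain ⟨j, rfl⟩ := hy
    have hq : p ^ e - 1 + 1 = p ^ e := Nat.sub_add_cancel (pow_pos (Fact.out : p.Prime).pos e)
    rw [← Finset.mul_prod_erase _ _ (Finset.mem_univ j), mul_pow, mul_right_comm, ← pow_succ, hq,
      hφ]
    exact Ideal.mul_mem_right _ _ (Ideal.subset_span (Set.mem_range_self j))
  | zero => simp
  | add y z _ _ h1 h2 =>
    rw [mul_add, map_add]
    exact Ideal.add_mem _ (h1 φ hφ) (h2 φ hφ)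
  | smul c y _ h =>
    -- The multiplier c is absorbed into φ, hence the induction over all φ.
    have := h (φ.comp (AddMonoidHom.mulLeft c)) fun r s => by
      simp only [AddMonoidHom.comp_apply, AddMonoidHom.coe_mulLeft]
      rw [mul_left_comm, hφ]
    simpa [mul_left_comm] using this

theorem exists_isRootLinear_pow_eq_one {f : MvPolynomial σ L} (hf : ∀ i, degreeOf i f ≤ 1)
    (hf0 : f ≠ 0) (e : ℕ) : ∃ φ : MvPolynomial σ L →+ MvPolynomial σ L,
      IsRootLinear (p ^ e) φ ∧ φ (f ^ (p ^ e - 1)) = 1 := by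
  obtain ⟨M, hM⟩ := exists_coeff_ne_zero hf0
  obtain ⟨ψ, hψ, h1⟩ := exists_isRootLinear_field L p e (pow_ne_zero (p ^ e - 1) hM)
  have hM1 : ∀ i, M i ≤ 1 := fun i =>
    (monomial_le_degreeOf i (mem_support_iff.2 hM)).trans (hf i)
  have hq : 0 < p ^ e := pow_pos (Fact.out : p.Prime).pos e
  refine ⟨cartierMap _ hq.ne' ψ ((p ^ e - 1) • M), isRootLinear_cartierMap e hq.ne' hψ _ ?_, ?_⟩
  · intro i
    have := Nat.mul_le_mul_left (p ^ e - 1) (hM1 i)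
    simp
    omega
  · have := cartierMap_pow_mul_C hf M hM1 hq.ne' ψ 1
    rwa [C_1, mul_one, mul_one, h1, C_1] at this

/-- Every ideal of the quotient of a polynomial ring by the factors of a square-free supported
polynomial is tightly closed, provided that the Rayleigh differences of the factors do not
vanish. -/
theorem isTightlyClosed_of_ker_eq_span [Fintype σ] {F : ι → MvPolynomial σ L}
    (hF : ∀ i, degreeOf i (∏ j, F j) ≤ 1) {x : ι → σ}
    (hx : ∀ j, degreeOf (x j) (F j) = 1) (hx' : ∀ j k, k ≠ j → degreeOf (x k) (F j) = 0)
    (hF1 : ∀ j i, degreeOf i (F j) ≤ 1)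
    (hΔ : ∀ j y, y ≠ x j → degreeOf y (F j) ≠ 0 → rayleigh (x j) y (F j) ≠ 0)
    {B : Type*} [CommRing B] {π : MvPolynomial σ L →+* B} (hπ : Function.Surjective π)
    (hker : RingHom.ker π = Ideal.span (Set.range F)) (I : Ideal B) : IsTightlyClosed p I := by
  classical
  have hF0 (j) : F j ≠ 0 := by
    intro h
    have := hx j
    rw [h, degreeOf_zero] at this
    omega
  refine isTightlyClosed_of_isCompatible_ker (f := ∏ j, F j) hπ ?_
    (exists_isRootLinear_pow_eq_one hF (Finset.prod_ne_zero_iff.2 fun j _ => hF0 j)) ?_ I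
  · rw [hker]
    exact isCompatible_span_range F
  · intro P hP hPc hkP P₀ hP₀ hkP₀ hle h hh
    have hzero (a) (ha : a ∈ supported L (Set.range x)ᶜ) (haP : a ∈ P) : a = 0 := by
      refine hPc.eq_zero_of_vars_subset hF hF1 hF0 x hΔ hP
        (Finset.univ.filter fun i => i ∉ Set.range x) (fun j hj => ?_) a haP fun i hi => ?_
      · exact (Finset.mem_filter.1 hj).2 (Set.mem_range_self j)
      · exact Finset.mem_filter.2 ⟨Finset.mem_univ i, mem_supported.1 ha hi⟩
    obtain ⟨a, ha, r, hr, ha0, h1⟩ := exists_mul_sub_mem_span hx hx' h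
    rw [← hker] at h1
    have hr0 : r = 0 := by
      refine hzero r hr ?_
      rw [← sub_sub_cancel (a * h) r]
      exact P.sub_mem (P.mul_mem_left _ hh) (hkP h1)
    rw [hr0, sub_zero] at h1
    exact (hP₀.mem_or_mem (hkP₀ h1)).resolve_left fun ha' => ha0 (hzero a ha (hle ha'))

end Hypersurface

/-! ### Base change and conclusion -/

section BaseChange

variable {σ K : Type*} [Field K]

theorem exists_surjective_baseChange (L : Type*) [Field L] [Algebra K L]
    {ι : Type*} {F : ι → MvPolynomial σ K} {R : Type*} [CommRing R] [Algebra K R]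
    {q : MvPolynomial σ K →ₐ[K] R} (hq : Function.Surjective q)
    (hker : RingHom.ker q = Ideal.span (Set.range F)) :
    ∃ π : MvPolynomial σ L →+* R ⊗[K] L, Function.Surjective π ∧
      RingHom.ker π = Ideal.span (Set.range fun j => map (algebraMap K L) (F j)) := by
  let E := algebraTensorAlgEquiv (σ := σ) K L
  let τ : L ⊗[K] MvPolynomial σ K →ₐ[K] L ⊗[K] R :=
    Algebra.TensorProduct.map (AlgHom.id K L) q
  let c := Algebra.TensorProduct.comm K L R
  have hτ : Function.Surjective τ :=
    Algebra.TensorProduct.map_surjective _ _ Function.surjective_id hq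
  have hkτ : RingHom.ker τ = (Ideal.span (Set.range F)).map
      (Algebra.TensorProduct.includeRight : MvPolynomial σ K →ₐ[K] L ⊗[K] MvPolynomial σ K) := by
    rw [← hker]
    exact Algebra.TensorProduct.lTensor_ker (A := L) q hq
  refine ⟨(c.toRingEquiv.toRingHom.comp τ.toRingHom).comp E.symm.toRingEquiv.toRingHom,
    (c.surjective.comp hτ).comp E.symm.surjective, ?_⟩
  have h1 : RingHom.ker ((c.toRingEquiv.toRingHom.comp τ.toRingHom).comp
      E.symm.toRingEquiv.toRingHom) = (RingHom.ker τ).comap E.symm.toRingEquiv := by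
    ext s
    change c (τ (E.symm s)) = 0 ↔ τ (E.symm s) = 0
    simp
  rw [h1, hkτ, Ideal.map_span, ← Set.range_comp]
  change Ideal.comap (E.toRingEquiv.symm) _ = _
  rw [← Ideal.map_comap_of_equiv, Ideal.map_span, ← Set.range_comp]
  congr 2
  ext j : 1
  change E (1 ⊗ₜ F j) = _
  rw [algebraTensorAlgEquiv_tmul, one_smul]

end BaseChange

theorem isGeometricallyFRational_of_isSquarefreeSupported (p : ℕ) (hp : p.Prime) (K : Type u) [Field K] [CharP K p]
    (n : ℕ) (f : MvPolynomial (Fin n) K) (hf : IsSquarefreeSupported f)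
    (t : ℕ) (F : Fin t → MvPolynomial (Fin n) K) (hirr : ∀ i, Irreducible (F i))
    (hprod : Associated (∏ i, F i) f) :
    IsGeometricallyFRational.{w} p K
      (MvPolynomial (Fin n) K ⧸ Ideal.span (Set.range F)) := by
  classical
  intro L _ _
  have : Fact p.Prime := ⟨hp⟩
  have : CharP L p := charP_of_injective_algebraMap (algebraMap K L).injective p
  have hF0 (j) : F j ≠ 0 := (hirr j).ne_zero
  have hprod0 : ∏ j, F j ≠ 0 := Finset.prod_ne_zero_iff.2 fun j _ => hF0 j
  have hdeg (i) : degreeOf i (∏ j, F j) ≤ 1 := by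
    obtain ⟨v, hv⟩ := hprod
    have h1 : degreeOf i f ≤ 1 := degreeOf_le_iff.2 fun m hm => hf m hm i
    rw [← hv, degreeOf_mul_eq hprod0 v.ne_zero] at h1
    omega
  -- Degrees add over the factors, so each variable occurs in at most one of them.
  have hsum (i) : ∑ j, degreeOf i (F j) ≤ 1 := by
    have := hdeg i
    rwa [degreeOf_prod_eq _ _ fun j _ => hF0 j] at this
  have hF1 (j i) : degreeOf i (F j) ≤ 1 :=
    (Finset.single_le_sum (f := fun j => degreeOf i (F j)) (fun _ _ => Nat.zero_le _)
      (Finset.mem_univ j)).trans (hsum i)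
  have hvar (j) : ∃ i, degreeOf i (F j) = 1 := by
    by_contra! hcon
    have hv : (F j).vars = ∅ := Finset.eq_empty_of_forall_notMem fun i hi => by
      have h1 := mem_vars_iff_degreeOf_ne_zero.1 hi
      have h2 := hF1 j i
      have h3 := hcon i
      omega
    rw [vars_eq_empty_iff_eq_C] at hv
    refine (hirr j).not_isUnit ?_
    have h0 : coeff 0 (F j) ≠ 0 := fun h => hF0 j (by rw [hv, h, C_0])
    rw [hv]
    exact (IsUnit.mk0 _ h0).map C
  choose x hx using hvar
  have hx' (j k) (hkj : k ≠ j) : degreeOf (x k) (F j) = 0 := by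
    have h1 := hsum (x k)
    rw [← Finset.add_sum_erase _ _ (Finset.mem_univ k), hx k] at h1
    have h2 := Finset.single_le_sum (f := fun j => degreeOf (x k) (F j))
      (fun _ _ => Nat.zero_le _) (Finset.mem_erase.2 ⟨hkj.symm, Finset.mem_univ j⟩)
    omega
  let G : Fin t → MvPolynomial (Fin n) L := fun j => map (algebraMap K L) (F j)
  have hGd (i) (H : MvPolynomial (Fin n) K) :
      degreeOf i (map (algebraMap K L) H) = degreeOf i H :=
    degreeOf_map_of_injective (algebraMap K L).injective i H
  have hGx (j) : degreeOf (x j) (G j) = 1 := (hGd _ _).trans (hx j)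
  have hGx' (j k) (hkj : k ≠ j) : degreeOf (x k) (G j) = 0 := (hGd _ _).trans (hx' j k hkj)
  obtain ⟨π, hπ, hker⟩ := exists_surjective_baseChange L (F := F)
    (Ideal.Quotient.mkₐ_surjective K (Ideal.span (Set.range F))) (Ideal.Quotient.mkₐ_ker K _)
  have : Nontrivial ((MvPolynomial (Fin n) K ⧸ Ideal.span (Set.range F)) ⊗[K] L) := by
    refine ⟨⟨0, 1, fun h => span_range_ne_top hGx hGx' ?_⟩⟩
    rw [Ideal.eq_top_iff_one, ← hker, RingHom.mem_ker, map_one, h]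
  refine ⟨hp, ?_, isNoetherianRing_of_surjective _ _ π hπ, fun I _ => ?_⟩
  · exact charP_of_injective_algebraMap (algebraMap K _).injective p
  · refine isTightlyClosed_of_ker_eq_span (F := G) (x := x) (fun i => ?_) hGx hGx'
      (fun j i => (hGd _ _).trans_le (hF1 j i)) (fun j y hy h0 => ?_) hπ hker I
    · have h1 : ∏ j, G j = map (algebraMap K L) (∏ j, F j) := (map_prod _ _ _).symm
      rw [h1, hGd]
      exact hdeg i
    · have h1 := (hGd y (F j)).symm.trans_ne h0
      have h2 := hF1 j y
      rw [rayleigh_map, Ne, map_eq_zero_iff _ (map_injective _ (algebraMap K L).injective)]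
      exact rayleigh_ne_zero (hirr j) (hx j) (by omega)

end FSing

theorem theorem2p9 (p : ℕ) (hp : p.Prime) (K : Type u) [Field K] [CharP K p]
    (n : ℕ) (f : MvPolynomial (Fin n) K) (hf : FSing.IsSquarefreeSupported f)
    (t : ℕ) (F : Fin t → MvPolynomial (Fin n) K) (hirr : ∀ i, Irreducible (F i))
    (hprod : Associated (∏ i, F i) f) :
    FSing.IsGeometricallyFRational.{w} p K
      (MvPolynomial (Fin n) K ⧸ Ideal.span (Set.range F)) :=
  FSing.isGeometricallyFRational_of_isSquarefreeSupported p hp K n f hf t F hirr hprod
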